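/- For each sample size $n\in\mathbb{N}$ let $K=K_n$ be a dimension, let $D^*=D^*_n$ belong to the set $\mathcal{B}(\mathbb{R}^K)$ of real $K\times K$ matrices of rank $K$ all of whose columns have Euclidean norm $1$, and let $\alpha=(\alpha_1,\dots,\alpha_K)$ be a random vector in $\mathbb{R}^{K}$ (its law may depend on $n$) such that: (I) there is $c_\alpha>0$ (possibly depending on $n$) with $\sum_{k=1}^K \mathbb{E}\big[\,|\sum_{j=1}^K A_{k,j}\alpha_j|\,\mathbf{1}(\alpha_k=0)\big]\ge c_\alpha\|A\|_F$ for every $A\in\mathbb{R}^{K\times K}$ with zero diagonal; (II) for all fixed $c_1,\dots,c_K\in\mathbb{R}$, almost surely $\sum_{l} c_l\alpha_l=0$ implies $c_l\alpha_l=0$ for every $l$; and $\|\alpha\|_\infty\le L$ almost surely, where $L<\infty$ does not depend on $n$. Draw $n$ i.i.d. copies $\alpha^{(1)},\dots,\alpha^{(n)}$ of $\alpha$, observe the signals $x^{(i)}=D^*\alpha^{(i)}$, and let $L_n(D)=\frac1n\sum_{i=1}^n\|D^{-1}x^{(i)}\|_1$ for $D\in\mathcal{B}(\mathbb{R}^K)$.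 A dictionary $D_0\in\mathcal{B}(\mathbb{R}^K)$ is called a sharp local minimum of $L_n$ with sharpness $\epsilon'$ if there is $\delta>0$ such that, for all $D\in\mathcal{B}(\mathbb{R}^K)$ with $\|D-D_0\|_F<\delta$, $L_n(D)-L_n(D_0)\ge \epsilon'\|D-D_0\|_F+o(\|D-D_0\|_F)$ (as $D\to D_0$). Two dictionaries are equal up to sign-permutation if $D=D'P\Lambda$ with $P$ a permutation matrix and $\Lambda$ a diagonal matrix with diagonal entries $\pm1$. If $\frac{K_n\ln K_n}{n}\to0$ as $n\to\infty$, then for any fixed $\epsilon,\rho>0$, as $n\to\infty$, $$P\Big(\text{there is } D\in\mathcal{B}(\mathbb{R}^{K}),\ D\neq D^*\text{ up to sign-permutation, with } \|D^{-1}\|_2\le\rho,\ \text{that is a sharp local minimum of } L_n \text{ with sharpness at least } \epsilon\Big)\to0,$$ where $\|\cdot\|_2$ is the spectral norm. -/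

import Mathlib

open MeasureTheory ProbabilityTheory Filter Topology Asymptotics

noncomputable section

namespace DictLearning

/-- The Frobenius norm of a square real matrix. -/
def frobNorm {K : ℕ} (A : Matrix (Fin K) (Fin K) ℝ) : ℝ :=
  Real.sqrt (∑ i, ∑ j, A i j ^ 2)

/-- The spectral norm of a square real matrix: its operator norm on Euclidean space. -/
def specNorm {K : ℕ} (A : Matrix (Fin K) (Fin K) ℝ) : ℝ :=
  ‖Matrix.toEuclideanCLM (n := Fin K) (𝕜 := ℝ) A‖

/-- The feasible (complete) dictionaries: `K × K` matrices of full rank whose columns (atoms)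
have Euclidean norm one. -/
def dictionaries (K : ℕ) : Set (Matrix (Fin K) (Fin K) ℝ) :=
  {D | (∀ j, ‖(WithLp.toLp 2 (fun i => D i j) : EuclideanSpace ℝ (Fin K))‖ = 1) ∧ D.rank = K}

/-- `D` and `D'` are the same dictionary up to sign-permutation: `D = D' P Λ` with `P` a
permutation matrix and `Λ` a diagonal matrix with diagonal entries `1` or `-1`. -/
def SignPermEquiv {K : ℕ} (D D' : Matrix (Fin K) (Fin K) ℝ) : Prop :=
  ∃ (σ : Equiv.Perm (Fin K)) (s : Fin K → ℝ), (∀ j, s j = 1 ∨ s j = -1) ∧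
    D = D' * σ.permMatrix ℝ * Matrix.diagonal s

/-- The empirical objective `(1 / n) ∑ᵢ ‖D⁻¹ x⁽ⁱ⁾‖₁` of the signals `x⁽¹⁾, …, x⁽ⁿ⁾`. -/
def objective {K n : ℕ} (x : Fin n → Fin K → ℝ) (D : Matrix (Fin K) (Fin K) ℝ) : ℝ :=
  (1 / (n : ℝ)) * ∑ i, ∑ k, |(D⁻¹).mulVec (x i) k|

/-- The dictionary `D₀` is a sharp local minimum of `F` over the feasible dictionaries, with
sharpness `ε`: near `D₀`, `F D - F D₀ ≥ ε ‖D - D₀‖_F + o(‖D - D₀‖_F)`. -/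
def IsSharpLocalMin {K : ℕ} (F : Matrix (Fin K) (Fin K) ℝ → ℝ)
    (D₀ : Matrix (Fin K) (Fin K) ℝ) (ε : ℝ) : Prop :=
  D₀ ∈ dictionaries K ∧
    ∃ r : Matrix (Fin K) (Fin K) ℝ → ℝ,
      r =o[𝓝[dictionaries K] D₀] (fun D => frobNorm (D - D₀)) ∧
      ∃ δ : ℝ, 0 < δ ∧ ∀ D ∈ dictionaries K, frobNorm (D - D₀) < δ →
        ε * frobNorm (D - D₀) + r D ≤ F D - F D₀

/-- `D₀` is a sharp local minimum of `F` with sharpness at least `ε`. -/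
def IsSharpLocalMinAtLeast {K : ℕ} (F : Matrix (Fin K) (Fin K) ℝ → ℝ)
    (D₀ : Matrix (Fin K) (Fin K) ℝ) (ε : ℝ) : Prop :=
  ∃ ε' : ℝ, ε ≤ ε' ∧ IsSharpLocalMin F D₀ ε'

/-- The semi-norm on matrices induced by a random vector `α` of law `ν`:
`∑ₖ 𝔼 |∑ⱼ A k j * αⱼ| 1(αₖ = 0)`. -/
def coefSeminorm {K : ℕ} (ν : Measure (Fin K → ℝ)) (A : Matrix (Fin K) (Fin K) ℝ) : ℝ :=
  ∑ k, ∫ a, |∑ j, A k j * a j| * (if a k = 0 then 1 else 0) ∂ν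

/-- Regularity of the coefficient law: the induced semi-norm dominates a positive multiple of the
Frobenius norm on the matrices with zero diagonal. -/
def AssumptionI {K : ℕ} (ν : Measure (Fin K → ℝ)) : Prop :=
  ∃ c : ℝ, 0 < c ∧ ∀ A : Matrix (Fin K) (Fin K) ℝ, (∀ i, A i i = 0) →
    c * frobNorm A ≤ coefSeminorm ν A

/-- Coordinates of the coefficient vector almost surely do not cancel: for fixed constants `c`,
almost surely `∑ₗ cₗ αₗ = 0` implies that every `cₗ αₗ` vanishes. -/
def AssumptionII {K : ℕ} (ν : Measure (Fin K → ℝ)) : Prop :=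
  ∀ c : Fin K → ℝ, ∀ᵐ a ∂ν, (∑ l, c l * a l = 0) → ∀ l, c l * a l = 0

end DictLearning

end

/-!
For large `n` the event is in fact null.

Let `D` be a dictionary that is not equivalent to the reference `D'`, and `C = D⁻¹ D'`, so that the
signals have coefficients `β = C a` with respect to `D`. Some row `k` of `C` has two nonzero entries
(`exists_row_two_ne_zero`), as otherwise `C` would be a signed permutation matrix. This leaves room
for a direction `w` with `w k = 0` and `⟨w, β⟩ = a l` whenever `β k = 0`, for some `l` with
`C k l ≠ 0`; since the columns of `D'` have norm one, `‖w‖ ≥ 1 / (2 ρ)` (`exists_direction`).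

Move `D` along the normalized path `D (1 + t eₖ wᵀ)`. By the parallelogram law the column norms
change only at second order between `t` and `-t`, and `|β k - t s| + |β k + t s| = 2 |β k|` for
small `t` unless `β k = 0`. Hence the first-order part of the symmetric second difference of the
objective is carried by the samples with `β k = 0`, and a sharp minimum requires `ε ‖w‖ / (4 ρ)` to
be at most the average over all samples of `|a l|` restricted to `β k = 0`
(`IsSharpLocalMinAtLeast.le_average`).

Such a sample has `a l = 0` unless the row `c = C k` satisfies `⟨c, a⟩ = 0` through a genuine
cancellation. Although `D`, and hence `c`, depends on the sample, almost surely no `c` admits more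
than `K` cancelling samples (`ae_card_cancellations_le`): the vectors `c ∘ a` of those samples are
linearly independent, because membership of one more of them in the span of the others forces
orthogonality to a vector `c'` that depends on the others only, and independence allows assumption
(II) for this `c'`. So the average is at most `L K / n`, which is
impossible once `K / n` is small.
-/

noncomputable section
namespace DictLearning

/-! ### Cancellations in an i.i.d. sample -/

/-- The pairs `(x, a)` of a finite family `x` and a vector `a` for which some `c` with support `S`
is orthogonal to the whole family, while `c ∘ a` (coordinatewise product) is nonzero at `l₀` and is
a linear combination of the vectors `c ∘ x j`. -/
def cancellationSet {ι J : Type*} [Fintype ι] [Fintype J] (S : Finset ι) (l₀ : ι) :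
    Set ((J → ι → ℝ) × (ι → ℝ)) :=
  {p | ∃ c : ι → ℝ, (∀ l, c l ≠ 0 ↔ l ∈ S) ∧ (∀ j, ∑ l, c l * p.1 j l = 0) ∧
    (∃ b : J → ℝ, ∀ l, c l * p.2 l = ∑ j, b j * (c l * p.1 j l)) ∧ c l₀ * p.2 l₀ ≠ 0}

/-- A continuous image of a closed set is measurable when the domain is `σ`-compact. -/
lemma measurableSet_image_of_isClosed {X Y : Type*} [TopologicalSpace X] [SigmaCompactSpace X]
    [TopologicalSpace Y] [T2Space Y] [MeasurableSpace Y] [OpensMeasurableSpace Y] {f : X → Y}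
    (hf : Continuous f) {s : Set X} (hs : IsClosed s) : MeasurableSet (f '' s) := by
  obtain ⟨T, hT, hTs⟩ := (isSigmaCompact_univ.of_isClosed_subset hs s.subset_univ).image hf
  rw [← hTs]
  exact MeasurableSet.iUnion fun n => (hT n).isClosed.measurableSet

lemma measurableSet_cancellationSet {ι J : Type*} [Fintype ι] [Fintype J] (S : Finset ι) (l₀ : ι) :
    MeasurableSet (cancellationSet (J := J) S l₀) := by
  classical
  -- Reciprocals `d` and `e` as extra variables turn the conditions `≠ 0` into closed ones.
  let Z : Set (((J → ι → ℝ) × (ι → ℝ)) × (ι → ℝ) × (ι → ℝ) × (J → ℝ) × ℝ) :=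
    {q | (∀ l ∈ S, q.2.1 l * q.2.2.1 l = 1) ∧ (∀ l ∉ S, q.2.1 l = 0) ∧
      (∀ j, ∑ l, q.2.1 l * q.1.1 j l = 0) ∧
      (∀ l, q.2.1 l * q.1.2 l = ∑ j, q.2.2.2.1 j * (q.2.1 l * q.1.1 j l)) ∧
      q.2.1 l₀ * q.1.2 l₀ * q.2.2.2.2 = 1}
  have hZ : IsClosed Z := by
    refine IsClosed.and ?_ (IsClosed.and ?_ (IsClosed.and ?_ (IsClosed.and ?_ ?_)))
    · simp only [Set.ofPred_forall]
      exact isClosed_iInter fun l => isClosed_iInter fun _ =>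
        isClosed_eq (by fun_prop) (by fun_prop)
    · simp only [Set.ofPred_forall]
      exact isClosed_iInter fun l => isClosed_iInter fun _ =>
        isClosed_eq (by fun_prop) (by fun_prop)
    · simp only [Set.ofPred_forall]
      exact isClosed_iInter fun l => isClosed_eq (by fun_prop) (by fun_prop)
    · simp only [Set.ofPred_forall]
      exact isClosed_iInter fun l => isClosed_eq (by fun_prop) (by fun_prop)
    · exact isClosed_eq (by fun_prop) (by fun_prop)
  convert measurableSet_image_of_isClosed continuous_fst hZ using 1
  ext p
  constructor
  · rintro ⟨c, hc, horth, ⟨b, hb⟩, hne⟩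
    refine ⟨(p, c, c⁻¹, b, (c l₀ * p.2 l₀)⁻¹), ⟨?_, ?_, horth, hb, ?_⟩, rfl⟩
    · intro l hl
      exact mul_inv_cancel₀ ((hc l).2 hl)
    · intro l hl
      by_contra h
      exact hl ((hc l).1 h)
    · exact mul_inv_cancel₀ hne
  · rintro ⟨⟨p', c, d, b, e⟩, ⟨h1, h2, h3, h4, h5⟩, rfl⟩
    refine ⟨c, fun l => ⟨fun h => ?_, fun h h0 => ?_⟩, h3, ⟨b, h4⟩, fun h0 => ?_⟩
    · by_contra hl
      exact h (h2 l hl)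
    · have := h1 l h
      simp [h0] at this
    · simp [h0] at h5

/-- A coefficient vector almost surely creates no cancellation with a family fixed beforehand. -/
lemma measure_preimage_cancellationSet {K : ℕ} {J : Type*} [Fintype J] {ν : Measure (Fin K → ℝ)}
    (hII : AssumptionII ν) (S : Finset (Fin K)) (l₀ : Fin K) (x : J → Fin K → ℝ) :
    ν (Prod.mk x ⁻¹' cancellationSet S l₀) = 0 := by
  by_cases hx : ∃ c : Fin K → ℝ, (∀ l, c l ≠ 0 ↔ l ∈ S) ∧ ∀ j, ∑ l, c l * x j l = 0
  · -- The single vector `c` can replace every other one with the same support: whether `a` lies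
    -- in the span of the family on the coordinates of `S` depends on `S` only.
    obtain ⟨c, hc, horth⟩ := hx
    refine measure_mono_null ?_ (ae_iff.1 (hII c))
    rintro a ⟨c', hc', -, ⟨b, hb⟩, hne⟩ hcan
    have hspan : ∀ l, c l * a l = ∑ j, b j * (c l * x j l) := by
      intro l
      by_cases hl : l ∈ S
      · have hl' := (hc' l).2 hl
        have h := hb l
        have : a l = ∑ j, b j * x j l := by
          apply mul_left_cancel₀ hl'
          rw [h, Finset.mul_sum]
          exact Finset.sum_congr rfl fun j _ => by simp only; ring
        rw [this, Finset.mul_sum]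
        exact Finset.sum_congr rfl fun j _ => by ring
      · have : c l = 0 := by
          by_contra h
          exact hl ((hc l).1 h)
        simp [this]
    have hsum : ∑ l, c l * a l = 0 := by
      simp_rw [hspan]
      rw [Finset.sum_comm]
      refine Finset.sum_eq_zero fun j _ => ?_
      rw [← Finset.mul_sum, horth j, mul_zero]
    have h0 := hcan hsum l₀
    have hl₀ : l₀ ∈ S := (hc' l₀).1 (left_ne_zero_of_mul hne)
    exact (mul_ne_zero ((hc l₀).2 hl₀) (right_ne_zero_of_mul hne)) h0
  · refine measure_mono_null ?_ measure_empty
    rintro a ⟨c, hc, horth, -⟩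
    exact hx ⟨c, hc, horth⟩

lemma ae_notMem_cancellationSet {K n : ℕ} {ν : Measure (Fin K → ℝ)} [IsProbabilityMeasure ν]
    (hII : AssumptionII ν) {Ω : Type*} [MeasurableSpace Ω] {P : Measure Ω} [IsProbabilityMeasure P]
    {α : Fin n → Ω → Fin K → ℝ} (hlaw : ∀ i, HasLaw (α i) ν P) (hindep : iIndepFun α P)
    (J : Finset (Fin n)) {i : Fin n} (hi : i ∉ J) (S : Finset (Fin K)) (l₀ : Fin K) :
    ∀ᵐ ω ∂P, ((fun j : J => α j ω), α i ω) ∉ cancellationSet S l₀ := by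
  have hm : ∀ i, AEMeasurable (α i) P := fun i => (hlaw i).aemeasurable
  have hX : AEMeasurable (fun ω (j : J) => α j ω) P := aemeasurable_pi_lambda _ fun j => hm j
  have hind : IndepFun (fun ω (j : J) => α j ω) (α i) P :=
    (hindep.indepFun_finset₀ J {i} (by simpa using hi) hm).comp (φ := id)
      (ψ := fun f : (({i} : Finset (Fin n)) → Fin K → ℝ) => f ⟨i, by simp⟩)
      measurable_id (measurable_pi_apply _)
  have hmap := (indepFun_iff_map_prod_eq_prod_map_map hX (hm i)).1 hind
  rw [(hlaw i).map_eq] at hmap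
  have hmeas : MeasurableSet (cancellationSet (J := J) S l₀) := measurableSet_cancellationSet S l₀
  have h0 : P.map (fun ω => ((fun j : J => α j ω), α i ω)) (cancellationSet S l₀) = 0 := by
    rw [hmap, Measure.measure_prod_null hmeas]
    exact .of_forall fun x => measure_preimage_cancellationSet hII S l₀ x
  rw [Measure.map_apply_of_aemeasurable (hX.prodMk (hm i)) hmeas] at h0
  rw [ae_iff]
  simp only [not_not]
  exact h0

/-- Vectors orthogonal to `c` without the trivial reason that `c ∘ a i = 0` have linearly
independent products `c ∘ a i`, so there are at most `K` of them. -/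
lemma card_cancellations_le {K n : ℕ} (a : Fin n → Fin K → ℝ)
    (ha : ∀ (J : Finset (Fin n)) (i : Fin n), i ∉ J → ∀ S l₀,
      ((fun j : J => a j), a i) ∉ cancellationSet S l₀) (c : Fin K → ℝ) :
    (Finset.univ.filter fun i => ∑ l, c l * a i l = 0 ∧ ∃ l, c l * a i l ≠ 0).card ≤ K := by
  classical
  set T := Finset.univ.filter fun i => ∑ l, c l * a i l = 0 ∧ ∃ l, c l * a i l ≠ 0
  have hind : ∀ J : Finset (Fin n), J ⊆ T →
      LinearIndepOn ℝ (fun i => fun l => c l * a i l) (J : Set (Fin n)) := by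
    intro J
    induction J using Finset.induction_on with
    | empty => simp
    | insert i J hi ih =>
      intro hJ
      rw [Finset.coe_insert]
      refine (ih ((Finset.subset_insert _ _).trans hJ)).insert fun hspan => ?_
      rw [Submodule.mem_span_image_finset_iff_exists_fun] at hspan
      obtain ⟨b, hb⟩ := hspan
      obtain ⟨l₀, hl₀⟩ := (Finset.mem_filter.1 (hJ (Finset.mem_insert_self i J))).2.2
      refine ha J i hi (Finset.univ.filter fun l => c l ≠ 0) l₀
        ⟨c, by simp, fun j => ?_, ⟨b, fun l => ?_⟩, hl₀⟩
      · exact (Finset.mem_filter.1 (hJ (Finset.mem_insert_of_mem j.2))).2.1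
      · have := congrFun hb l
        simpa using this.symm
  have := (hind T subset_rfl).linearIndependent.fintype_card_le_finrank
  simpa using this

lemma ae_card_cancellations_le {K n : ℕ} {ν : Measure (Fin K → ℝ)} [IsProbabilityMeasure ν]
    (hII : AssumptionII ν) {Ω : Type*} [MeasurableSpace Ω] {P : Measure Ω} [IsProbabilityMeasure P]
    {α : Fin n → Ω → Fin K → ℝ} (hlaw : ∀ i, HasLaw (α i) ν P) (hindep : iIndepFun α P) :
    ∀ᵐ ω ∂P, ∀ c : Fin K → ℝ,
      (Finset.univ.filter fun i =>
        ∑ l, c l * α i ω l = 0 ∧ ∃ l, c l * α i ω l ≠ 0).card ≤ K := by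
  have h : ∀ᵐ ω ∂P, ∀ (J : Finset (Fin n)) (i : Fin n), i ∉ J → ∀ S l₀,
      ((fun j : J => α j ω), α i ω) ∉ cancellationSet S l₀ := by
    refine ae_all_iff.2 fun J => ae_all_iff.2 fun i => ?_
    by_cases hi : i ∈ J
    · exact .of_forall fun ω h => absurd hi h
    · filter_upwards [ae_all_iff.2 fun S => ae_all_iff.2 fun l₀ =>
        ae_notMem_cancellationSet hII hlaw hindep J hi S l₀] with ω hω _ using hω
  filter_upwards [h] with ω hω
  exact card_cancellations_le (fun i => α i ω) hω

variable {K : ℕ}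

/-! ### Dictionaries, norms and sharp minima -/

/-- The `j`-th column of a matrix, as a vector of Euclidean space. -/
def atom (D : Matrix (Fin K) (Fin K) ℝ) (j : Fin K) : EuclideanSpace ℝ (Fin K) :=
  WithLp.toLp 2 fun i => D i j

lemma isUnit_of_mem_dictionaries {D : Matrix (Fin K) (Fin K) ℝ} (hD : D ∈ dictionaries K) :
    IsUnit D := by
  rw [← Matrix.mulVec_surjective_iff_isUnit]
  have h : D.mulVecLin.range = ⊤ := by
    apply Submodule.eq_top_of_finrank_eq
    have := hD.2
    rw [Matrix.rank] at this
    simpa using this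
  exact LinearMap.range_eq_top.1 h

lemma norm_atom {D : Matrix (Fin K) (Fin K) ℝ} (hD : D ∈ dictionaries K) (j : Fin K) :
    ‖atom D j‖ = 1 := hD.1 j

lemma norm_atom_sq (D : Matrix (Fin K) (Fin K) ℝ) (j : Fin K) :
    ‖atom D j‖ ^ 2 = ∑ i, D i j ^ 2 := by
  simp [atom, EuclideanSpace.norm_sq_eq]

lemma norm_atom_mul_le (A B : Matrix (Fin K) (Fin K) ℝ) (j : Fin K) :
    ‖atom (A * B) j‖ ≤ specNorm A * ‖atom B j‖ := by
  have h : atom (A * B) j = Matrix.toEuclideanCLM (n := Fin K) (𝕜 := ℝ) A (atom B j) := by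
    rw [atom, atom, Matrix.toEuclideanCLM_toLp]
    rfl
  rw [h]
  exact ContinuousLinearMap.le_opNorm _ _

lemma frobNorm_sq (A : Matrix (Fin K) (Fin K) ℝ) : frobNorm A ^ 2 = ∑ j, ‖atom A j‖ ^ 2 := by
  rw [frobNorm, Real.sq_sqrt (by positivity), Finset.sum_comm]
  simp_rw [norm_atom_sq]

lemma frobNorm_nonneg (A : Matrix (Fin K) (Fin K) ℝ) : 0 ≤ frobNorm A := Real.sqrt_nonneg _

lemma row_sum_sq_le (A B : Matrix (Fin K) (Fin K) ℝ) (k : Fin K) :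
    ∑ j, (A * B) k j ^ 2 ≤ (specNorm A * frobNorm B) ^ 2 := by
  rw [mul_pow, frobNorm_sq, Finset.mul_sum]
  refine Finset.sum_le_sum fun j _ => ?_
  calc (A * B) k j ^ 2 ≤ ∑ i, (A * B) i j ^ 2 :=
        Finset.single_le_sum (f := fun i => (A * B) i j ^ 2) (fun i _ => sq_nonneg _)
          (Finset.mem_univ k)
    _ = ‖atom (A * B) j‖ ^ 2 := (norm_atom_sq _ _).symm
    _ ≤ (specNorm A * ‖atom B j‖) ^ 2 := by gcongr; exact norm_atom_mul_le A B j
    _ = _ := mul_pow _ _ _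

/-- A sharp local minimum absorbs the `o(‖D - D₀‖)` term at the price of half the sharpness. -/
lemma IsSharpLocalMinAtLeast.eventually_le {F : Matrix (Fin K) (Fin K) ℝ → ℝ}
    {D₀ : Matrix (Fin K) (Fin K) ℝ} {ε : ℝ} (hε : 0 < ε) (h : IsSharpLocalMinAtLeast F D₀ ε) :
    ∀ᶠ D in 𝓝[dictionaries K] D₀, ε / 2 * frobNorm (D - D₀) ≤ F D - F D₀ := by
  obtain ⟨ε', hεε', -, r, hr, δ, hδ, hF⟩ := h
  have hcont : Continuous fun D : Matrix (Fin K) (Fin K) ℝ => frobNorm (D - D₀) := by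
    unfold frobNorm
    simp only [Matrix.sub_apply]
    refine Real.continuous_sqrt.comp (continuous_finsetSum _ fun i _ =>
      continuous_finsetSum _ fun j _ => ?_)
    exact ((continuous_id.matrix_elem i j).sub continuous_const).pow 2
  have hlt : ∀ᶠ D in 𝓝[dictionaries K] D₀, frobNorm (D - D₀) < δ := by
    refine mem_nhdsWithin_of_mem_nhds (hcont.continuousAt.eventually_lt continuousAt_const ?_)
    simpa [frobNorm] using hδ
  filter_upwards [hlt, hr.def (half_pos hε), self_mem_nhdsWithin] with D h1 h2 h3
  have h4 := hF D h3 h1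
  rw [Real.norm_eq_abs, Real.norm_eq_abs, abs_of_nonneg (frobNorm_nonneg _)] at h2
  have h5 := neg_abs_le (r D)
  have h6 := mul_le_mul_of_nonneg_right hεε' (frobNorm_nonneg (D - D₀))
  linarith

/-! ### Perturbing one row of the inverse dictionary -/

/-- The norm of the `j`-th column of `D (1 + t eₖ wᵀ)`. -/
def pathNorm (D : Matrix (Fin K) (Fin K) ℝ) (k : Fin K) (w : Fin K → ℝ) (t : ℝ) (j : Fin K) : ℝ :=
  ‖atom D j + (t * w j) • atom D k‖

/-- The path `t ↦ D (1 + t eₖ wᵀ)` with columns rescaled to norm one. -/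
def dictPath (D : Matrix (Fin K) (Fin K) ℝ) (k : Fin K) (w : Fin K → ℝ) (t : ℝ) :
    Matrix (Fin K) (Fin K) ℝ :=
  D * (1 + Matrix.vecMulVec (Pi.single k t) w) * Matrix.diagonal fun j => (pathNorm D k w t j)⁻¹

variable {D : Matrix (Fin K) (Fin K) ℝ} {k : Fin K} {w : Fin K → ℝ}

lemma mul_one_add_vecMulVec_apply (t : ℝ) (i j : Fin K) :
    (D * (1 + Matrix.vecMulVec (Pi.single k t) w)) i j = D i j + t * w j * D i k := by
  rw [mul_add, mul_one, Matrix.add_apply, Matrix.mul_apply]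
  simp only [Matrix.vecMulVec_apply]
  rw [Finset.sum_eq_single k]
  · simp; ring
  · intro b _ hb; simp [hb]
  · simp

lemma pathNorm_zero (hD : D ∈ dictionaries K) (j : Fin K) : pathNorm D k w 0 j = 1 := by
  simp [pathNorm, norm_atom hD]

lemma pathNorm_self (hD : D ∈ dictionaries K) (hw : w k = 0) (t : ℝ) : pathNorm D k w t k = 1 := by
  simp [pathNorm, norm_atom hD, hw]

lemma continuous_pathNorm (j : Fin K) : Continuous fun t => pathNorm D k w t j := by
  unfold pathNorm
  fun_prop

/-- First-order terms of the column norms cancel between `t` and `-t`, by the parallelogram law. -/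
lemma pathNorm_add_pathNorm_neg_le (hD : D ∈ dictionaries K) (t : ℝ) (j : Fin K) :
    pathNorm D k w t j + pathNorm D k w (-t) j ≤ 2 + t ^ 2 * w j ^ 2 := by
  have h := parallelogram_law_with_norm ℝ (atom D j) ((t * w j) • atom D k)
  rw [norm_smul, norm_atom hD, norm_atom hD, Real.norm_eq_abs, mul_one, sq_abs] at h
  have hneg : pathNorm D k w (-t) j = ‖atom D j - (t * w j) • atom D k‖ := by
    rw [pathNorm, neg_mul, neg_smul, sub_eq_add_neg]
  rw [hneg, pathNorm]
  set x := ‖atom D j + (t * w j) • atom D k‖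
  set y := ‖atom D j - (t * w j) • atom D k‖
  refine le_of_sq_le_sq ?_ (by positivity)
  nlinarith [sq_nonneg (x - y), sq_nonneg (t ^ 2 * w j ^ 2)]

lemma vecMulVec_mul_self_eq_zero (hw : w k = 0) (s t : ℝ) :
    Matrix.vecMulVec (Pi.single k s) w * Matrix.vecMulVec (Pi.single k t) w = 0 := by
  rw [Matrix.vecMulVec_mul_vecMulVec]
  simp [hw]

lemma mul_dictPath_eq_one (hD : D ∈ dictionaries K) (hw : w k = 0) {t : ℝ}
    (ht : ∀ j, pathNorm D k w t j ≠ 0) :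
    Matrix.diagonal (pathNorm D k w t) * (1 - Matrix.vecMulVec (Pi.single k t) w) * D⁻¹ *
      dictPath D k w t = 1 := by
  have hdet := (Matrix.isUnit_iff_isUnit_det D).1 (isUnit_of_mem_dictionaries hD)
  set R := Matrix.vecMulVec (Pi.single k t) w
  have hR : R * R = 0 := vecMulVec_mul_self_eq_zero hw t t
  have hR' : (1 - R) * (1 + R) = 1 := by
    rw [sub_mul, mul_add, one_mul, mul_add, hR]; simp
  have hN : Matrix.diagonal (pathNorm D k w t) *
      Matrix.diagonal (fun j => (pathNorm D k w t j)⁻¹) = 1 := by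
    rw [Matrix.diagonal_mul_diagonal, ← Matrix.diagonal_one]
    congr 1
    funext j
    exact mul_inv_cancel₀ (ht j)
  calc _ = Matrix.diagonal (pathNorm D k w t) * ((1 - R) * (D⁻¹ * D * (1 + R))) *
        Matrix.diagonal (fun j => (pathNorm D k w t j)⁻¹) := by
        simp only [dictPath, Matrix.mul_assoc, R]
    _ = 1 := by rw [Matrix.nonsing_inv_mul D hdet, Matrix.one_mul, hR', Matrix.mul_one, hN]

lemma dictPath_mem (hD : D ∈ dictionaries K) (hw : w k = 0) {t : ℝ}
    (ht : ∀ j, pathNorm D k w t j ≠ 0) : dictPath D k w t ∈ dictionaries K := by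
  refine ⟨fun j => ?_, ?_⟩
  · have h : (WithLp.toLp 2 fun i => dictPath D k w t i j : EuclideanSpace ℝ (Fin K)) =
        (pathNorm D k w t j)⁻¹ • (atom D j + (t * w j) • atom D k) := by
      ext i
      simp only [dictPath, Matrix.mul_diagonal, mul_one_add_vecMulVec_apply, atom,
        PiLp.smul_apply, PiLp.add_apply, smul_eq_mul]
      ring
    rw [h, norm_smul, norm_inv, pathNorm, norm_norm]
    exact inv_mul_cancel₀ (ht j)
  · have h := Matrix.rank_of_isUnit (dictPath D k w t)
      ((Matrix.isUnit_iff_isUnit_det _).2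
        (Matrix.isUnit_det_of_left_inverse (mul_dictPath_eq_one hD hw ht)))
    simpa using h

lemma inv_dictPath_mulVec (hD : D ∈ dictionaries K) (hw : w k = 0) {t : ℝ}
    (ht : ∀ j, pathNorm D k w t j ≠ 0) (x : Fin K → ℝ) (j : Fin K) :
    ((dictPath D k w t)⁻¹).mulVec x j = pathNorm D k w t j *
      ((D⁻¹).mulVec x j - if j = k then t * ∑ m, w m * (D⁻¹).mulVec x m else 0) := by
  rw [Matrix.inv_eq_left_inv (mul_dictPath_eq_one hD hw ht), Matrix.mul_assoc, ← Matrix.mulVec_mulVec,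
    Matrix.mulVec_diagonal, ← Matrix.mulVec_mulVec, Matrix.sub_mulVec, Matrix.one_mulVec,
    Matrix.vecMulVec_mulVec]
  congr 1
  by_cases hj : j = k
  · subst hj
    simp [dotProduct, mul_comm]
  · simp [hj]

lemma eventually_pathNorm (hD : D ∈ dictionaries K) :
    ∀ᶠ t in 𝓝 (0 : ℝ), ∀ j, 0 < pathNorm D k w t j ∧ pathNorm D k w t j < 2 := by
  refine eventually_all.2 fun j => ?_
  have h : Tendsto (fun t => pathNorm D k w t j) (𝓝 0) (𝓝 1) := by
    simpa [pathNorm_zero hD] using (continuous_pathNorm (D := D) (k := k) (w := w) j).tendsto 0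
  exact (h.eventually (lt_mem_nhds one_pos)).and (h.eventually (gt_mem_nhds one_lt_two))

lemma tendsto_dictPath (hD : D ∈ dictionaries K) (hw : w k = 0) :
    Tendsto (dictPath D k w) (𝓝 0) (𝓝[dictionaries K] D) := by
  refine tendsto_nhdsWithin_iff.2 ⟨?_, ?_⟩
  · refine tendsto_pi_nhds.2 fun i => tendsto_pi_nhds.2 fun j => ?_
    have hc : ContinuousAt (fun t => (D i j + t * w j * D i k) * (pathNorm D k w t j)⁻¹) 0 := by
      refine ContinuousAt.mul (by fun_prop) (ContinuousAt.inv₀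
        (continuous_pathNorm j).continuousAt ?_)
      simp [pathNorm_zero hD]
    have h := hc.tendsto
    simp only [pathNorm_zero hD, zero_mul, add_zero, inv_one, mul_one] at h
    refine h.congr fun t => ?_
    rw [dictPath, Matrix.mul_diagonal, mul_one_add_vecMulVec_apply]
  · filter_upwards [eventually_pathNorm (k := k) (w := w) hD] with t ht
    exact dictPath_mem hD hw fun j => (ht j).1.ne'

/-- The path moves at least at speed `‖w‖ / (2 ‖D⁻¹‖₂)`, as read off in row `k` of
`D⁻¹ (D_t - D)`. -/
lemma le_frobNorm_dictPath_sub (hD : D ∈ dictionaries K) (hw : w k = 0) {t : ℝ}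
    (ht : ∀ j, 0 < pathNorm D k w t j ∧ pathNorm D k w t j < 2) :
    |t| * ‖(WithLp.toLp 2 w : EuclideanSpace ℝ (Fin K))‖ / 2 ≤
      specNorm D⁻¹ * frobNorm (dictPath D k w t - D) := by
  have hdet := (Matrix.isUnit_iff_isUnit_det D).1 (isUnit_of_mem_dictionaries hD)
  refine le_of_sq_le_sq ?_ (mul_nonneg (norm_nonneg _) (frobNorm_nonneg _))
  refine le_trans ?_ (row_sum_sq_le D⁻¹ _ k)
  have hrow : ∀ j, (D⁻¹ * (dictPath D k w t - D)) k j = t * w j / pathNorm D k w t j := by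
    intro j
    rw [mul_sub, dictPath, ← Matrix.mul_assoc, ← Matrix.mul_assoc, Matrix.nonsing_inv_mul D hdet,
      Matrix.one_mul, Matrix.sub_apply, Matrix.mul_diagonal, Matrix.add_apply,
      Matrix.vecMulVec_apply, Pi.single_eq_same]
    by_cases hj : k = j
    · subst hj
      simp [pathNorm_self hD hw, hw]
    · simp [Matrix.one_apply_ne hj, div_eq_mul_inv]
  simp_rw [hrow]
  rw [div_pow, mul_pow, sq_abs, EuclideanSpace.norm_sq_eq, Finset.mul_sum, Finset.sum_div]
  refine Finset.sum_le_sum fun j _ => ?_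
  rw [div_pow, mul_pow]
  simp only [Real.norm_eq_abs, sq_abs]
  have := ht j
  gcongr
  · exact pow_pos this.1 2
  · exact this.1.le
  · exact this.2.le

/-! ### The second difference of the objective -/

lemma abs_sub_add_abs_add_le {b s : ℝ} (h : b ≠ 0 → |s| ≤ |b|) :
    |b - s| + |b + s| ≤ 2 * |b| + if b = 0 then 2 * |s| else 0 := by
  by_cases hb : b = 0
  · simp [hb, two_mul]
  · rw [if_neg hb]
    have := h hb
    rcases abs_cases b with h1 | h1 <;> rcases abs_cases s with h2 | h2 <;>
    rcases abs_cases (b - s) with h3 | h3 <;> rcases abs_cases (b + s) with h4 | h4 <;> linarith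

/-- Only the samples whose `k`-th coefficient vanishes contribute at first order to the symmetric
second difference of the objective. -/
lemma eventually_objective_second_difference_le {n : ℕ} (x : Fin n → Fin K → ℝ)
    (hD : D ∈ dictionaries K) (hw : w k = 0) :
    ∃ C : ℝ, ∀ᶠ t in 𝓝[>] (0 : ℝ),
      objective x (dictPath D k w t) + objective x (dictPath D k w (-t)) - 2 * objective x D ≤
        C * t ^ 2 + 2 * t * ((1 / (n : ℝ)) * ∑ i,
          if (D⁻¹).mulVec (x i) k = 0 then |∑ m, w m * (D⁻¹).mulVec (x i) m| else 0) := by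
  set β : Fin n → Fin K → ℝ := fun i => (D⁻¹).mulVec (x i) with hβ
  set s : Fin n → ℝ := fun i => ∑ m, w m * β i m with hs
  refine ⟨(1 / (n : ℝ)) * ∑ i, ∑ j, w j ^ 2 * |β i j|, ?_⟩
  have hsmall : ∀ᶠ t in 𝓝 (0 : ℝ), ∀ i, β i k ≠ 0 → |t * s i| ≤ |β i k| := by
    refine eventually_all.2 fun i => ?_
    by_cases hb : β i k = 0
    · exact .of_forall fun t h => absurd hb h
    · have hc : Tendsto (fun t : ℝ => |t * s i|) (𝓝 0) (𝓝 0) := by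
        have : Continuous fun t : ℝ => |t * s i| := by fun_prop
        simpa using this.tendsto 0
      filter_upwards [hc.eventually (gt_mem_nhds (abs_pos.2 hb))] with t ht _ using ht.le
  have hN := eventually_pathNorm (k := k) (w := w) hD
  have hneg : Tendsto (fun t : ℝ => -t) (𝓝 0) (𝓝 0) := by simpa using (continuous_neg.tendsto (0:ℝ))
  filter_upwards [nhdsWithin_le_nhds hsmall, nhdsWithin_le_nhds hN,
    nhdsWithin_le_nhds (hneg.eventually hN), self_mem_nhdsWithin] with t h1 h2 h3 htpos
  have htpos' : 0 < t := htpos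
  have key : ∀ i j, |((dictPath D k w t)⁻¹).mulVec (x i) j| +
      |((dictPath D k w (-t))⁻¹).mulVec (x i) j| ≤ 2 * |β i j| + t ^ 2 * (w j ^ 2 * |β i j|) +
        if j = k then (if β i k = 0 then 2 * t * |s i| else 0) else 0 := by
    intro i j
    rw [inv_dictPath_mulVec hD hw (fun j => (h2 j).1.ne'),
      inv_dictPath_mulVec hD hw (fun j => (h3 j).1.ne')]
    by_cases hj : j = k
    · subst hj
      simp only [if_true, pathNorm_self hD hw, one_mul, neg_mul, sub_neg_eq_add, hw]
      have := abs_sub_add_abs_add_le (h1 i)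
      rw [abs_mul, abs_of_pos htpos', ← mul_assoc] at this
      simpa using this
    · simp only [if_neg hj, sub_zero, add_zero, abs_mul, abs_of_pos (h2 j).1, abs_of_pos (h3 j).1]
      rw [← add_mul]
      calc _ ≤ (2 + t ^ 2 * w j ^ 2) * |β i j| :=
            mul_le_mul_of_nonneg_right (pathNorm_add_pathNorm_neg_le hD t j) (abs_nonneg _)
        _ = _ := by ring
  have hsum : ∑ i, (∑ j, |((dictPath D k w t)⁻¹).mulVec (x i) j| +
      ∑ j, |((dictPath D k w (-t))⁻¹).mulVec (x i) j|) ≤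
      2 * (∑ i, ∑ j, |β i j|) + t ^ 2 * (∑ i, ∑ j, w j ^ 2 * |β i j|) +
        2 * t * ∑ i, if β i k = 0 then |s i| else 0 := by
    rw [Finset.mul_sum, Finset.mul_sum, Finset.mul_sum, ← Finset.sum_add_distrib,
      ← Finset.sum_add_distrib]
    refine Finset.sum_le_sum fun i _ => ?_
    rw [← Finset.sum_add_distrib]
    refine (Finset.sum_le_sum fun j _ => key i j).trans_eq ?_
    rw [Finset.sum_add_distrib, Finset.sum_add_distrib, ← Finset.mul_sum, ← Finset.mul_sum]
    simp
  rw [Finset.sum_add_distrib] at hsum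
  have := mul_le_mul_of_nonneg_left hsum (show 0 ≤ 1 / (n : ℝ) by positivity)
  simp only [objective]
  linarith

/-- At a sharp local minimum, every direction `w` in row `k` is paid for by the samples whose `k`-th
coefficient vanishes. -/
lemma IsSharpLocalMinAtLeast.le_average {n : ℕ} {x : Fin n → Fin K → ℝ} {ε ρ : ℝ} (hε : 0 < ε)
    (hρ : 0 < ρ) (hD : D ∈ dictionaries K) (h : IsSharpLocalMinAtLeast (objective x) D ε)
    (hDρ : specNorm D⁻¹ ≤ ρ) (hw : w k = 0) :
    ε * ‖(WithLp.toLp 2 w : EuclideanSpace ℝ (Fin K))‖ / (4 * ρ) ≤ (1 / (n : ℝ)) * ∑ i,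
      if (D⁻¹).mulVec (x i) k = 0 then |∑ m, w m * (D⁻¹).mulVec (x i) m| else 0 := by
  obtain ⟨C, hC⟩ := eventually_objective_second_difference_le x hD hw
  set M := (1 / (n : ℝ)) * ∑ i,
      if (D⁻¹).mulVec (x i) k = 0 then |∑ m, w m * (D⁻¹).mulVec (x i) m| else 0
  set W := ‖(WithLp.toLp 2 w : EuclideanSpace ℝ (Fin K))‖
  have hgrow : ∀ᶠ t in 𝓝 (0 : ℝ), ε / 2 * (|t| * W / (2 * ρ)) ≤
      objective x (dictPath D k w t) - objective x D := by
    filter_upwards [(tendsto_dictPath hD hw).eventually (h.eventually_le hε),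
      eventually_pathNorm (k := k) (w := w) hD] with t h1 h2
    refine le_trans (mul_le_mul_of_nonneg_left ?_ (half_pos hε).le) h1
    have h3 := (le_frobNorm_dictPath_sub hD hw h2).trans
      (mul_le_mul_of_nonneg_right hDρ (frobNorm_nonneg _))
    rw [div_le_iff₀ (by positivity)]
    linarith
  have hneg : Tendsto (fun t : ℝ => -t) (𝓝 0) (𝓝 0) := by simpa using (continuous_neg.tendsto (0:ℝ))
  have hlim : Tendsto (fun t : ℝ => C * t / 2 + M) (𝓝[>] 0) (𝓝 M) := by
    have : Continuous fun t : ℝ => C * t / 2 + M := by fun_prop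
    simpa using (this.tendsto 0).mono_left nhdsWithin_le_nhds
  refine ge_of_tendsto hlim ?_
  filter_upwards [hC, nhdsWithin_le_nhds hgrow, nhdsWithin_le_nhds (hneg.eventually hgrow),
    self_mem_nhdsWithin] with t h1 h2 h3 htpos
  have ht : 0 < t := htpos
  rw [abs_neg] at h3
  rw [abs_of_pos ht] at h2 h3
  have h4 : (2 * t) * (ε * W / (4 * ρ)) ≤ (2 * t) * (C * t / 2 + M) := by
    have : (2 * t) * (ε * W / (4 * ρ)) =
        ε / 2 * (t * W / (2 * ρ)) + ε / 2 * (t * W / (2 * ρ)) := by field_simp; ring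
    rw [this]
    linarith
  exact le_of_mul_le_mul_left h4 (by positivity)

/-! ### Dictionaries that are not equivalent to the reference -/

/-- If every row of `D⁻¹ D'` has at most one nonzero entry, then `D⁻¹ D'` is a signed permutation
matrix. -/
lemma exists_row_two_ne_zero {D D' : Matrix (Fin K) (Fin K) ℝ} (hD : D ∈ dictionaries K)
    (hD' : D' ∈ dictionaries K) (h : ¬ SignPermEquiv D D') :
    ∃ k l₁ l₂, l₁ ≠ l₂ ∧ (D⁻¹ * D') k l₁ ≠ 0 ∧ (D⁻¹ * D') k l₂ ≠ 0 := by
  by_contra! hrow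
  apply h
  have hdet := (Matrix.isUnit_iff_isUnit_det D).1 (isUnit_of_mem_dictionaries hD)
  set C := D⁻¹ * D' with hC
  have hDC : D * C = D' := by rw [hC, ← Matrix.mul_assoc, Matrix.mul_nonsing_inv D hdet, one_mul]
  -- No column of `C` vanishes, which gives a map from columns to rows, injective by assumption.
  have hcol : ∀ l, ∃ k, C k l ≠ 0 := by
    intro l
    by_contra! hl
    have h0 : atom D' l = 0 := by
      ext i
      have : D' i l = 0 := by
        rw [← hDC, Matrix.mul_apply]
        exact Finset.sum_eq_zero fun k _ => by rw [hl k, mul_zero]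
      simpa [atom] using this
    have := norm_atom hD' l
    rw [h0, norm_zero] at this
    exact zero_ne_one this
  choose τ hτ using hcol
  have hinj : Function.Injective τ := by
    intro l₁ l₂ hl
    by_contra hne
    exact hτ l₂ (hl ▸ hrow (τ l₁) l₁ l₂ hne (hτ l₁))
  let e : Equiv.Perm (Fin K) := Equiv.ofBijective τ (Finite.injective_iff_bijective.1 hinj)
  have he : ∀ l, e l = τ l := fun l => rfl
  have hentry : ∀ i l, D' i l = C (e l) l * D i (e l) := by
    intro i l
    rw [← hDC, Matrix.mul_apply, Finset.sum_eq_single (e l), mul_comm]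
    · intro b _ hb
      by_contra hne
      have hbl : C b l ≠ 0 := right_ne_zero_of_mul hne
      have h1 : C b (e.symm b) ≠ 0 := by
        have := hτ (e.symm b)
        rwa [← he, e.apply_symm_apply] at this
      refine h1 (hrow b l (e.symm b) (fun hl => hb ?_) hbl)
      rw [hl, e.apply_symm_apply]
    · simp
  have hsign : ∀ l, C (e l) l = 1 ∨ C (e l) l = -1 := by
    intro l
    have h1 : atom D' l = C (e l) l • atom D (e l) := by
      ext i
      simpa [atom] using hentry i l
    have h2 := congrArg norm h1
    rw [norm_smul, norm_atom hD', norm_atom hD, mul_one, Real.norm_eq_abs] at h2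
    exact eq_or_eq_neg_of_abs_eq h2.symm
  refine ⟨e, fun j => C j (e.symm j), fun j => ?_, ?_⟩
  · simpa using hsign (e.symm j)
  · ext i j
    rw [Matrix.mul_diagonal, Equiv.Perm.permMatrix, PEquiv.mul_toMatrix_toPEquiv,
      Matrix.submatrix_apply, id, hentry, e.apply_symm_apply]
    rcases hsign (e.symm j) with h1 | h1 <;> rw [e.apply_symm_apply] at h1 <;> rw [h1] <;> ring

/-- If row `k` of `C = D⁻¹ D'` has two nonzero entries, some `w` with `w k = 0` turns the
coefficients `β = C a` that satisfy `β k = 0` into a single coordinate `a l` with `C k l ≠ 0`;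
moreover `w` is not small. -/
lemma exists_direction {D D' : Matrix (Fin K) (Fin K) ℝ} (hD : D ∈ dictionaries K)
    (hD' : D' ∈ dictionaries K) (h : ¬ SignPermEquiv D D') :
    ∃ (k l : Fin K) (w : Fin K → ℝ), (D⁻¹ * D') k l ≠ 0 ∧ w k = 0 ∧
      (∀ a : Fin K → ℝ, (D⁻¹ * D').mulVec a k = 0 → ∑ j, w j * (D⁻¹ * D').mulVec a j = a l) ∧
      1 / 2 ≤ specNorm D⁻¹ * ‖(WithLp.toLp 2 w : EuclideanSpace ℝ (Fin K))‖ := by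
  obtain ⟨k, l₁, l, hne, hl₁, hl, hle⟩ : ∃ k l₁ l, l₁ ≠ l ∧ (D⁻¹ * D') k l₁ ≠ 0 ∧
      (D⁻¹ * D') k l ≠ 0 ∧ |(D⁻¹ * D') k l| ≤ |(D⁻¹ * D') k l₁| := by
    obtain ⟨k, l₁, l₂, hne, h1, h2⟩ := exists_row_two_ne_zero hD hD' h
    rcases le_total |(D⁻¹ * D') k l₂| |(D⁻¹ * D') k l₁| with h3 | h3
    · exact ⟨k, l₁, l₂, hne, h1, h2, h3⟩
    · exact ⟨k, l₂, l₁, hne.symm, h2, h1, h3⟩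
  have hdet := (Matrix.isUnit_iff_isUnit_det D).1 (isUnit_of_mem_dictionaries hD)
  have hdet' := (Matrix.isUnit_iff_isUnit_det D').1 (isUnit_of_mem_dictionaries hD')
  set C := D⁻¹ * D' with hC
  set G := D'⁻¹ * D with hG
  have hGC : G * C = 1 := by
    rw [hG, hC, Matrix.mul_assoc, ← Matrix.mul_assoc D, Matrix.mul_nonsing_inv D hdet,
      Matrix.one_mul, Matrix.nonsing_inv_mul D' hdet']
  set w : Fin K → ℝ := fun j => if j = k then 0 else G l j
  have hw : ∀ v : Fin K → ℝ, ∑ j, w j * v j = ∑ j, G l j * v j - G l k * v k := by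
    intro v
    rw [eq_sub_iff_add_eq, ← Finset.add_sum_erase _ _ (Finset.mem_univ k),
      ← Finset.add_sum_erase _ (fun j => G l j * v j) (Finset.mem_univ k)]
    have : ∑ j ∈ Finset.univ.erase k, w j * v j = ∑ j ∈ Finset.univ.erase k, G l j * v j :=
      Finset.sum_congr rfl fun j hj => by simp [w, Finset.ne_of_mem_erase hj]
    rw [this]
    simp [w, add_comm]
  have hcol : ∀ m, |∑ j, w j * C j m| ≤
      specNorm D⁻¹ * ‖(WithLp.toLp 2 w : EuclideanSpace ℝ (Fin K))‖ := by
    intro m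
    have h1 : ∑ j, w j * C j m = inner ℝ (atom C m) (WithLp.toLp 2 w) := by
      simp [atom, PiLp.inner_apply]
    have h2 : ‖atom C m‖ ≤ specNorm D⁻¹ := by
      simpa [norm_atom hD'] using norm_atom_mul_le D⁻¹ D' m
    rw [h1]
    exact (abs_real_inner_le_norm _ _).trans (mul_le_mul_of_nonneg_right h2 (norm_nonneg _))
  have hval : ∀ m, ∑ j, w j * C j m = (if l = m then 1 else 0) - G l k * C k m := by
    intro m
    have := congrFun (congrFun hGC l) m
    rw [Matrix.mul_apply, Matrix.one_apply] at this
    rw [hw fun j => C j m, this]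
  refine ⟨k, l, w, hl, by simp [w], fun a ha => ?_, ?_⟩
  · rw [hw, ha, mul_zero, sub_zero]
    have : ∑ j, G l j * C.mulVec a j = (G * C).mulVec a l := by
      rw [← Matrix.mulVec_mulVec a G C]; rfl
    rw [this, hGC, Matrix.one_mulVec]
  · -- `wᵀ C = eₗ - γ Cₖ` cannot be small at both `l` and `l₁`, as `|C k l| ≤ |C k l₁|`.
    have h1 := hcol l
    have h2 := hcol l₁
    rw [hval, if_pos rfl] at h1
    rw [hval, if_neg hne.symm, zero_sub, abs_neg, abs_mul] at h2
    have h3 : |G l k * C k l| ≤ |G l k| * |C k l₁| := by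
      rw [abs_mul]; exact mul_le_mul_of_nonneg_left hle (abs_nonneg _)
    have h4 := le_abs_self (G l k * C k l)
    have h5 := le_abs_self (1 - G l k * C k l)
    linarith

/-- A spurious sharp local minimum forces the sample size to be at most a multiple of the
dimension. -/
lemma le_of_isSharpLocalMinAtLeast {n : ℕ} {D D' : Matrix (Fin K) (Fin K) ℝ}
    (hD' : D' ∈ dictionaries K) {a : Fin n → Fin K → ℝ} {L ε ρ : ℝ} (hL : 0 ≤ L)
    (haL : ∀ i j, |a i j| ≤ L)
    (hcard : ∀ c : Fin K → ℝ,
      (Finset.univ.filter fun i => ∑ l, c l * a i l = 0 ∧ ∃ l, c l * a i l ≠ 0).card ≤ K)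
    (hε : 0 < ε) (hρ : 0 < ρ) (hDD' : ¬ SignPermEquiv D D') (hDρ : specNorm D⁻¹ ≤ ρ)
    (hmin : IsSharpLocalMinAtLeast (objective fun i => D'.mulVec (a i)) D ε) :
    ε / (8 * ρ ^ 2) ≤ L * (K / n) := by
  have hD : D ∈ dictionaries K := by
    obtain ⟨_, _, hD, _⟩ := hmin
    exact hD
  obtain ⟨k, l, w, hkl, hwk, hw, hnorm⟩ := exists_direction hD hD' hDD'
  set W := ‖(WithLp.toLp 2 w : EuclideanSpace ℝ (Fin K))‖
  have hW : 1 / 2 ≤ ρ * W := hnorm.trans (mul_le_mul_of_nonneg_right hDρ (norm_nonneg _))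
  have havg := hmin.le_average hε hρ hD hDρ hwk
  simp_rw [Matrix.mulVec_mulVec] at havg
  set T := Finset.univ.filter fun i =>
    ∑ m, (D⁻¹ * D') k m * a i m = 0 ∧ ∃ m, (D⁻¹ * D') k m * a i m ≠ 0
  have hsum : (∑ i, if (D⁻¹ * D').mulVec (a i) k = 0 then
      |∑ m, w m * (D⁻¹ * D').mulVec (a i) m| else 0) ≤ K * L := by
    calc _ ≤ ∑ i, if i ∈ T then L else 0 := by
          refine Finset.sum_le_sum fun i _ => ?_
          by_cases h0 : (D⁻¹ * D').mulVec (a i) k = 0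
          · rw [if_pos h0, hw _ h0]
            by_cases hT : i ∈ T
            · rw [if_pos hT]; exact haL i l
            · rw [if_neg hT]
              have : a i l = 0 := by
                by_contra hne
                exact hT (Finset.mem_filter.2 ⟨Finset.mem_univ _, h0, l, mul_ne_zero hkl hne⟩)
              simp [this]
          · rw [if_neg h0]
            split_ifs <;> simp [hL]
      _ = T.card * L := by simp
      _ ≤ K * L := by gcongr; exact hcard _
  have h1 : ε * W / (4 * ρ) ≤ L * (K / n) := by
    refine havg.trans ((mul_le_mul_of_nonneg_left hsum (by positivity)).trans_eq ?_)
    ring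
  refine le_trans ?_ h1
  rw [div_le_div_iff₀ (by positivity) (by positivity)]
  have h2 := mul_le_mul_of_nonneg_left hW (show 0 ≤ 8 * ε * ρ by positivity)
  linarith

/-- In dimension at most one every dictionary is equivalent to every other one. -/
lemma two_le_of_not_signPermEquiv {D D' : Matrix (Fin K) (Fin K) ℝ} (hD : D ∈ dictionaries K)
    (hD' : D' ∈ dictionaries K) (h : ¬ SignPermEquiv D D') : 2 ≤ K := by
  obtain ⟨-, l₁, l₂, hne, -⟩ := exists_row_two_ne_zero hD hD' h
  have h1 := l₁.2
  have h2 := l₂.2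
  have h3 : l₁.1 ≠ l₂.1 := fun h => hne (Fin.ext h)
  omega

end DictLearning

end

theorem theorem4
    -- the dimension, which may depend on the sample size `n`
    (K : ℕ → ℕ)
    (hK : Tendsto (fun n : ℕ => (K n : ℝ) * Real.log (K n) / n) atTop (𝓝 0))
    -- the reference dictionaries
    (Dstar : ∀ n, Matrix (Fin (K n)) (Fin (K n)) ℝ)
    (hDstar : ∀ n, Dstar n ∈ DictLearning.dictionaries (K n))
    -- the laws of the reference coefficient vectors
    (ν : ∀ n, Measure (Fin (K n) → ℝ)) [∀ n, IsProbabilityMeasure (ν n)]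
    (hI : ∀ n, DictLearning.AssumptionI (ν n))
    (hII : ∀ n, DictLearning.AssumptionII (ν n))
    (L : ℝ) (hL : ∀ n, ∀ᵐ a ∂(ν n), ∀ j, |a j| ≤ L)
    -- for every `n`, a sample of `n` i.i.d. coefficient vectors
    {Ω : ℕ → Type*} [∀ n, MeasurableSpace (Ω n)]
    (P : ∀ n, Measure (Ω n)) [∀ n, IsProbabilityMeasure (P n)]
    (α : ∀ n, Fin n → Ω n → (Fin (K n) → ℝ))
    (hlaw : ∀ n i, HasLaw (α n i) (ν n) (P n))
    (hindep : ∀ n, iIndepFun (α n) (P n))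
    (ε ρ : ℝ) (hε : 0 < ε) (hρ : 0 < ρ) :
    Tendsto
      (fun n => P n {ω | ∃ D : Matrix (Fin (K n)) (Fin (K n)) ℝ,
        ¬ DictLearning.SignPermEquiv D (Dstar n) ∧
        DictLearning.specNorm D⁻¹ ≤ ρ ∧
        DictLearning.IsSharpLocalMinAtLeast
          (DictLearning.objective (fun i => (Dstar n).mulVec (α n i ω))) D ε})
      atTop (𝓝 0) := by
  have hlog : 0 < Real.log 2 := Real.log_pos one_lt_two
  set η := ε / (8 * ρ ^ 2)
  have hη : 0 < η := by positivity
  have hlim : Tendsto (fun n : ℕ => |L| * ((K n : ℝ) * Real.log (K n) / n / Real.log 2))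
      atTop (𝓝 0) := by
    simpa using (hK.div_const (Real.log 2)).const_mul |L|
  refine tendsto_const_nhds.congr' ?_
  filter_upwards [hlim.eventually (gt_mem_nhds hη)] with n hn
  -- For such `n` the event is null.
  symm
  have hbound : ∀ᵐ ω ∂P n, ∀ i j, |α n i ω j| ≤ |L| := by
    refine ae_all_iff.2 fun i => ?_
    have h1 : ∀ᵐ a ∂((P n).map (α n i)), ∀ j, |a j| ≤ L := by
      rw [(hlaw n i).map_eq]
      exact hL n
    filter_upwards [ae_of_ae_map (hlaw n i).aemeasurable h1] with ω hω j using
      (hω j).trans (le_abs_self L)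
  have hae : ∀ᵐ ω ∂P n, ω ∉ {ω | ∃ D : Matrix (Fin (K n)) (Fin (K n)) ℝ,
        ¬ DictLearning.SignPermEquiv D (Dstar n) ∧
        DictLearning.specNorm D⁻¹ ≤ ρ ∧
        DictLearning.IsSharpLocalMinAtLeast
          (DictLearning.objective (fun i => (Dstar n).mulVec (α n i ω))) D ε} := by
    filter_upwards [hbound,
      DictLearning.ae_card_cancellations_le (hII n) (hlaw n) (hindep n)] with ω h1 h2
    rintro ⟨D, hne, hDρ, hmin⟩
    have hD : D ∈ DictLearning.dictionaries (K n) := by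
      obtain ⟨_, _, hD, _⟩ := hmin
      exact hD
    have h3 := DictLearning.le_of_isSharpLocalMinAtLeast (hDstar n) (a := fun i => α n i ω)
      (abs_nonneg L) h1 h2 hε hρ hne hDρ hmin
    have hK2 : (2 : ℝ) ≤ K n := by
      exact_mod_cast DictLearning.two_le_of_not_signPermEquiv hD (hDstar n) hne
    have hlogK : Real.log 2 ≤ Real.log (K n) := Real.log_le_log two_pos hK2
    have h4 : (K n : ℝ) / n ≤ (K n : ℝ) * Real.log (K n) / n / Real.log 2 := by
      rw [le_div_iff₀ hlog, mul_div_right_comm]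
      gcongr
    have h5 := mul_le_mul_of_nonneg_left h4 (abs_nonneg L)
    linarith
  have := ae_iff.1 hae
  simp only [not_not] at this
  exact this
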